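/- Let $\mathcal{A}$ be a bicomplete abelian category. For an object $I$, a map $f : X \to Y$ of $\mathcal{A}$ is called $I$-monic if the induced map of abelian groups $\mathcal{A}(f,I) : \mathcal{A}(Y,I) \to \mathcal{A}(X,I)$ is surjective; for a class $\mathcal{I}$ of objects, $f$ is $\mathcal{I}$-monic if it is $I$-monic for every $I \in \mathcal{I}$. An injective class on $\mathcal{A}$ is a class $\mathcal{I}$ of objects (called the $\mathcal{I}$-injectives) together with a class $\mathcal{M}$ of maps such that (i) $\mathcal{M}$ is precisely the class of all $\mathcal{I}$-monic maps, (ii) $\mathcal{I}$ is precisely the class of all objects $I$ such that every map in $\mathcal{M}$ is $I$-monic, and (iii) for each object $X$ there is a map $X \to I$ in $\mathcal{M}$ with $I \in \mathcal{I}$. **Corollary 5.2 (Bousfield model structure).** Let $\mathcal{A}$ be a bicomplete abelian category with an injective class $\mathcal{I}$ (with class of maps $\mathcal{M}$). Then the category $\mathrm{Ch}^{\geq 0}(\mathcal{A})$ of non-negatively graded cochain complexes in $\mathcal{A}$ has a model structure (weak equivalences with the two-out-of-three property, the three classes closed under retracts, lifting, and factorization, the factorizations not being required to be functorial) in which: 1.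 a map $f$ is a weak equivalence if and only if, for every $I \in \mathcal{I}$, the map of chain complexes of abelian groups $\mathcal{A}(f,I)$, obtained by applying $\mathcal{A}(-,I)$ degreewise, is a quasi-isomorphism; 2. a map $f$ is a cofibration if and only if, for every $n > 0$ (but not necessarily for $n = 0$), its component $f^n$ in degree $n$ is $\mathcal{I}$-monic; 3. a map $f$ is a fibration if and only if, for every $n \geq 0$, its component $f^n$ is a split epimorphism whose kernel is in $\mathcal{I}$. Moreover, every complex is cofibrant, and a complex $X$ is fibrant if and only if $X^n \in \mathcal{I}$ for every $n \geq 0$. -/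

import Mathlib

open CategoryTheory CategoryTheory.Limits HomotopicalAlgebra

universe v u

namespace RelativeInjective

variable {A : Type u} [Category.{v} A]

/-- A map `f : X ⟶ Y` is `I`-monic if the induced map `A(f, I) : A(Y, I) → A(X, I)` is
surjective. -/
def IsMonicFor (I : A) {X Y : A} (f : X ⟶ Y) : Prop :=
  Function.Surjective (fun g : Y ⟶ I => f ≫ g)

/-- An injective class on `A` is a class `𝓘` of objects (the `𝓘`-injectives) together with a
class `𝓜` of maps such that `𝓜` consists of exactly the `𝓘`-monic maps, `𝓘` consists of exactly
the objects relative to which every map of `𝓜` is monic, and every object is the source of a map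
in `𝓜` whose target is in `𝓘`. -/
structure IsInjectiveClass (𝓘 : ObjectProperty A) (𝓜 : MorphismProperty A) : Prop where
  mem_maps_iff : ∀ {X Y : A} (f : X ⟶ Y), 𝓜 f ↔ ∀ I : A, 𝓘 I → IsMonicFor I f
  mem_objects_iff : ∀ I : A, 𝓘 I ↔ ∀ ⦃X Y : A⦄ (f : X ⟶ Y), 𝓜 f → IsMonicFor I f
  exists_map : ∀ X : A, ∃ (I : A) (f : X ⟶ I), 𝓘 I ∧ 𝓜 f

/-- The functor `A(-, I)`, applied degreewise: it sends a cochain complex `X` to the chain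
complex of abelian groups which is `A(X^n, I)` in degree `n`, with the differential
`A(X^{n+1}, I) → A(X^n, I)` given by precomposition with that of `X`.
The complex shape `(ComplexShape.up ℕ).symm` is that of chain complexes indexed by `ℕ`. -/
noncomputable def homInto [Preadditive A] (I : A) :
    (CochainComplex A ℕ)ᵒᵖ ⥤
      HomologicalComplex AddCommGrpCat.{v} (ComplexShape.up ℕ).symm :=
  HomologicalComplex.opFunctor A (ComplexShape.up ℕ) ⋙
    (preadditiveYoneda.obj I).mapHomologicalComplex (ComplexShape.up ℕ).symm

section Classes

variable [Abelian A] (𝓘 : ObjectProperty A)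

/-- The maps `f` such that `A(f, I)` is a quasi-isomorphism for each `I` in `𝓘`. -/
def bousfieldWeakEquivalences : MorphismProperty (CochainComplex A ℕ) :=
  fun _ _ f => ∀ I : A, 𝓘 I → QuasiIso ((homInto I).map f.op)

/-- The maps that are `𝓘`-monic in each positive degree. -/
def bousfieldCofibrations : MorphismProperty (CochainComplex A ℕ) :=
  fun _ _ f => ∀ I : A, 𝓘 I → ∀ n : ℕ, 0 < n → IsMonicFor I (f.f n)

/-- The maps that are, in each degree, a split epimorphism whose kernel is in `𝓘`. -/
def bousfieldFibrations : MorphismProperty (CochainComplex A ℕ) :=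
  fun _ _ f => ∀ n : ℕ, IsSplitEpi (f.f n) ∧ 𝓘 (kernel (f.f n))

end Classes

end RelativeInjective

/-! Call a map `X^n ⟶ I` with `I` in `𝓘` a cochain of `X`, and a cocycle if the incoming
differential kills it. Unwinding the quasi-isomorphisms on cochains, `f : X ⟶ Y` is a trivial
cofibration exactly when `HasExtensions` holds.

A fibration is, in each degree, a split projection with kernel in `𝓘`. Pushing a lift up one degree
poses an extension problem with values in that kernel, which `HasExtensions` solves; this lifts
trivial cofibrations against fibrations.

Cofibrations lift against `addDisksFst`, since a map to the disk on `J n` is just a map to `J n` in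
degree `n`. Relative monics into objects of `𝓘` give both factorizations: through `addDisks`, and
through a complex built by successive pushouts. Factoring a trivial fibration through `addDisks`
exhibits it as a retract of `addDisksFst`, which gives the remaining lifting. -/

/-! ### Quasi-isomorphisms in terms of elements -/

/-- A map of complexes of abelian groups is a quasi-isomorphism in a given degree if and only if
it is injective and surjective on classes of cycles. -/
lemma HomologicalComplex.quasiIsoAt_iff_of_addCommGrp {ι : Type*} {c : ComplexShape ι}
    {K L : HomologicalComplex AddCommGrpCat.{v} c} (φ : K ⟶ L) (i j k : ι)
    (hi : c.prev j = i) (hk : c.next j = k) :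
    QuasiIsoAt φ j ↔
      (∀ x : K.X j, K.d j k x = 0 → ∀ y : L.X i, L.d i j y = φ.f j x →
        ∃ x' : K.X i, K.d i j x' = x) ∧
      (∀ y : L.X j, L.d j k y = 0 → ∃ x : K.X j, K.d j k x = 0 ∧
        ∃ y' : L.X i, y = φ.f j x + L.d i j y') := by
  have cyc (M : HomologicalComplex AddCommGrpCat.{v} c) (x : M.X j) (hx : M.d j k x = 0) :
      ∃ z : M.cycles j, M.iCycles j z = x := by
    have ex : (ShortComplex.mk _ _ (M.iCycles_d j k)).Exact :=
      ShortComplex.exact_of_f_is_kernel _ (M.cyclesIsKernel j k hk)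
    exact (ShortComplex.ab_exact_iff _).1 ex x hx
  have icyc (M : HomologicalComplex AddCommGrpCat.{v} c) :
      Function.Injective (M.iCycles j) := (AddCommGrpCat.mono_iff_injective _).1 inferInstance
  have dcyc (M : HomologicalComplex AddCommGrpCat.{v} c) (z : M.cycles j) :
      M.d j k (M.iCycles j z) = 0 := by
    rw [← ConcreteCategory.comp_apply, M.iCycles_d]; rfl
  have surj (M : HomologicalComplex AddCommGrpCat.{v} c) :
      Function.Surjective (M.homologyπ j) := (AddCommGrpCat.epi_iff_surjective _).1 inferInstance
  have zero (M : HomologicalComplex AddCommGrpCat.{v} c) (z : M.cycles j) :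
      M.homologyπ j z = 0 ↔ ∃ y : M.X i, M.d i j y = M.iCycles j z := by
    have ex : (ShortComplex.mk _ _ (M.toCycles_comp_homologyπ i j)).Exact :=
      ShortComplex.exact_of_g_is_cokernel _ (M.homologyIsCokernel i j hi)
    rw [ShortComplex.ab_exact_iff] at ex
    constructor
    · intro hz
      obtain ⟨y, hy⟩ := ex z hz
      refine ⟨y, ?_⟩
      rw [← hy]
      exact (ConcreteCategory.congr_hom (M.toCycles_i i j) y).symm
    · rintro ⟨y, hy⟩
      have : z = M.toCycles i j y := icyc M (by
        rw [← hy]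
        exact (ConcreteCategory.congr_hom (M.toCycles_i i j) y).symm)
      rw [this]
      exact ConcreteCategory.congr_hom (M.toCycles_comp_homologyπ i j) y
  have nat (z : K.cycles j) : HomologicalComplex.homologyMap φ j (K.homologyπ j z) =
      L.homologyπ j (HomologicalComplex.cyclesMap φ j z) :=
    ConcreteCategory.congr_hom (HomologicalComplex.homologyπ_naturality φ j) z
  have nati (z : K.cycles j) : L.iCycles j (HomologicalComplex.cyclesMap φ j z) =
      φ.f j (K.iCycles j z) :=
    ConcreteCategory.congr_hom (HomologicalComplex.cyclesMap_i φ j) z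
  rw [quasiIsoAt_iff_isIso_homologyMap, ConcreteCategory.isIso_iff_bijective]
  constructor
  · rintro ⟨h1, h2⟩
    refine ⟨fun x hx y hy => ?_, fun y hy => ?_⟩
    · obtain ⟨z, rfl⟩ := cyc K x hx
      rw [← zero]
      apply h1
      rw [nat, map_zero, zero]
      exact ⟨y, by rw [hy, nati]⟩
    · obtain ⟨w, rfl⟩ := cyc L y hy
      obtain ⟨t, ht⟩ := h2 (L.homologyπ j w)
      obtain ⟨z, rfl⟩ := surj K t
      refine ⟨K.iCycles j z, dcyc K z, ?_⟩
      have : L.homologyπ j (w - HomologicalComplex.cyclesMap φ j z) = 0 := by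
        rw [map_sub, ← nat, ht, sub_self]
      obtain ⟨y', hy'⟩ := (zero _ _).1 this
      refine ⟨y', ?_⟩
      rw [hy', map_sub, nati]
      abel
  · rintro ⟨h1, h2⟩
    refine ⟨(injective_iff_map_eq_zero _).2 fun t ht => ?_, fun t => ?_⟩
    · obtain ⟨z, rfl⟩ := surj K t
      rw [nat, zero] at ht
      obtain ⟨y, hy⟩ := ht
      rw [zero]
      exact h1 _ (dcyc K z) y (by rw [hy, nati])
    · obtain ⟨w, rfl⟩ := surj L t
      obtain ⟨x, hx, y', hy'⟩ := h2 _ (dcyc L w)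
      obtain ⟨z, rfl⟩ := cyc K x hx
      refine ⟨K.homologyπ j z, ?_⟩
      rw [nat, ← sub_eq_zero, ← map_sub, zero]
      refine ⟨-y', ?_⟩
      rw [map_sub, nati, hy', map_neg]
      abel

namespace RelativeInjective

variable {A : Type u} [Category.{v} A] [Abelian A]

/-- Contravariance exchanges `next` and `prev`. At `j = 0` the default `k = 0` is harmless, as `Y.d
0 0 = 0`. -/
lemma quasiIsoAt_homInto_iff (I : A) {X Y : CochainComplex A ℕ} (f : X ⟶ Y) (i j k : ℕ)
    (hi : (ComplexShape.up ℕ).next j = i) (hk : (ComplexShape.up ℕ).prev j = k) :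
    QuasiIsoAt ((homInto I).map f.op) j ↔
      (∀ b : Y.X j ⟶ I, Y.d k j ≫ b = 0 → ∀ a : X.X i ⟶ I, X.d j i ≫ a = f.f j ≫ b →
        ∃ c : Y.X i ⟶ I, Y.d j i ≫ c = b) ∧
      (∀ a : X.X j ⟶ I, X.d k j ≫ a = 0 → ∃ b : Y.X j ⟶ I, Y.d k j ≫ b = 0 ∧
        ∃ a' : X.X i ⟶ I, a = f.f j ≫ b + X.d j i ≫ a') :=
  HomologicalComplex.quasiIsoAt_iff_of_addCommGrp _ i j k hi hk

end RelativeInjective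

/-! ### Closure properties of injective classes -/

namespace RelativeInjective

variable {A : Type u} [Category.{v} A]

lemma IsMonicFor.exists_fac {I X Y : A} {f : X ⟶ Y} (hf : IsMonicFor I f) (g : X ⟶ I) :
    ∃ g' : Y ⟶ I, f ≫ g' = g := hf g

namespace IsInjectiveClass

variable {𝓘 : ObjectProperty A} {𝓜 : MorphismProperty A}

lemma of_retract (h : IsInjectiveClass 𝓘 𝓜) {I J : A} (r : Retract I J) (hJ : 𝓘 J) : 𝓘 I := by
  rw [h.mem_objects_iff]
  intro X Y f hf g
  obtain ⟨g', hg'⟩ := ((h.mem_objects_iff J).1 hJ f hf).exists_fac (g ≫ r.i)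
  exact ⟨g' ≫ r.r, by simp [reassoc_of% hg']⟩

lemma exists_isMonicFor (h : IsInjectiveClass 𝓘 𝓜) (X : A) :
    ∃ (J : A) (f : X ⟶ J), 𝓘 J ∧ ∀ I : A, 𝓘 I → IsMonicFor I f := by
  obtain ⟨J, f, hJ, hf⟩ := h.exists_map X
  exact ⟨J, f, hJ, (h.mem_maps_iff f).1 hf⟩

lemma biprod [Preadditive A] [HasBinaryBiproducts A] (h : IsInjectiveClass 𝓘 𝓜) {I J : A}
    (hI : 𝓘 I) (hJ : 𝓘 J) : 𝓘 (I ⊞ J) := by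
  rw [h.mem_objects_iff]
  intro X Y f hf g
  obtain ⟨a, ha⟩ := ((h.mem_objects_iff I).1 hI f hf).exists_fac (g ≫ biprod.fst)
  obtain ⟨b, hb⟩ := ((h.mem_objects_iff J).1 hJ f hf).exists_fac (g ≫ biprod.snd)
  refine ⟨biprod.lift a b, ?_⟩
  apply biprod.hom_ext <;> simp [ha, hb]

lemma of_isZero [HasZeroMorphisms A] (h : IsInjectiveClass 𝓘 𝓜) {I : A} (hI : IsZero I) :
    𝓘 I := by
  rw [h.mem_objects_iff]
  intro X Y f hf g
  exact ⟨0, hI.eq_of_tgt _ _⟩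

lemma kernel_biprod_fst [Abelian A] (h : IsInjectiveClass 𝓘 𝓜) (Y : A) {J : A} (hJ : 𝓘 J) :
    𝓘 (kernel (biprod.fst : Y ⊞ J ⟶ Y)) :=
  h.of_retract (J := J)
    { i := kernel.ι _ ≫ biprod.snd
      r := kernel.lift _ biprod.inr (by simp)
      retract := by
        rw [← cancel_mono (kernel.ι _)]
        apply biprod.hom_ext <;> simp } hJ

end IsInjectiveClass

/-! ### Trivial cofibrations as extension problems -/

variable [Abelian A] (𝓘 : ObjectProperty A)

/-- An elementwise description of the trivial cofibrations: for `I` in `𝓘`, the pairs of a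
cochain of `X` and a cocycle of `Y` that are compatible extend to a cochain of `Y`. -/
structure HasExtensions {X Y : CochainComplex A ℕ} (f : X ⟶ Y) : Prop where
  zero (I : A) (hI : 𝓘 I) : IsMonicFor I (f.f 0)
  succ (I : A) (hI : 𝓘 I) (n : ℕ) (a : X.X (n + 1) ⟶ I) (b : Y.X n ⟶ I)
    (hb : ∀ m, Y.d m n ≫ b = 0) (h : f.f n ≫ b = X.d n (n + 1) ≫ a) :
    ∃ c : Y.X (n + 1) ⟶ I, Y.d n (n + 1) ≫ c = b ∧ f.f (n + 1) ≫ c = a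

variable {𝓘} {X Y : CochainComplex A ℕ} {f : X ⟶ Y}

lemma d_comp_eq_zero {X : CochainComplex A ℕ} {I : A} {n : ℕ} {b : X.X n ⟶ I}
    (k : ℕ) (hk : (ComplexShape.up ℕ).prev n = k) (h : X.d k n ≫ b = 0) (m : ℕ) :
    X.d m n ≫ b = 0 := by
  by_cases hm : (ComplexShape.up ℕ).Rel m n
  · rwa [← (ComplexShape.up ℕ).prev_eq' hm, hk]
  · rw [X.shape _ _ hm, zero_comp]

lemma HasExtensions.exists_cocycle (hf : HasExtensions 𝓘 f) (I : A) (hI : 𝓘 I) (n : ℕ)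
    (a : X.X n ⟶ I) (ha : ∀ m, X.d m n ≫ a = 0) :
    ∃ b : Y.X n ⟶ I, (∀ m, Y.d m n ≫ b = 0) ∧ f.f n ≫ b = a := by
  cases n with
  | zero =>
    obtain ⟨b, hb⟩ := (hf.zero I hI).exists_fac a
    exact ⟨b, fun m => by rw [Y.shape _ _ (by simp), zero_comp], hb⟩
  | succ n =>
    -- Prescribing the coboundary 0 makes the extension a cocycle.
    obtain ⟨b, hb, hb'⟩ := hf.succ I hI n a 0 (by simp) (by simp [ha])
    exact ⟨b, d_comp_eq_zero n (by simp) (by simpa using hb), hb'⟩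

lemma HasExtensions.isMonicFor (hf : HasExtensions 𝓘 f) (I : A) (hI : 𝓘 I) (n : ℕ) :
    IsMonicFor I (f.f n) := by
  cases n with
  | zero => exact hf.zero I hI
  | succ n =>
    intro a
    -- The coboundary of `a` is a cocycle, so it extends first; `a` is then extended compatibly.
    obtain ⟨b, hb, hb'⟩ := hf.exists_cocycle I hI n (X.d n (n + 1) ≫ a) (by simp)
    obtain ⟨c, -, hc⟩ := hf.succ I hI n a b hb hb'
    exact ⟨c, hc⟩

lemma HasExtensions.bousfieldCofibrations (hf : HasExtensions 𝓘 f) :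
    RelativeInjective.bousfieldCofibrations 𝓘 f := fun I hI n _ => hf.isMonicFor I hI n

lemma HasExtensions.bousfieldWeakEquivalences (hf : HasExtensions 𝓘 f) :
    RelativeInjective.bousfieldWeakEquivalences 𝓘 f := fun I hI => by
  rw [quasiIso_iff]
  intro n
  rw [quasiIsoAt_homInto_iff I f (n + 1) n _ (by simp) rfl]
  refine ⟨fun b hb a ha => ?_, fun a ha => ?_⟩
  · obtain ⟨c, hc, -⟩ := hf.succ I hI n a b (d_comp_eq_zero _ rfl hb) ha.symm
    exact ⟨c, hc⟩
  · obtain ⟨b, hb, hb'⟩ := hf.exists_cocycle I hI n a (d_comp_eq_zero _ rfl ha)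
    exact ⟨b, hb _, 0, by simp [hb']⟩

/-- Cocycles extend up to a coboundary, and monicity one degree higher corrects this. Only positive
degrees are used; in degree 0 every cochain is a cocycle, so monicity there follows. -/
lemma hasExtensions_of_cofibration_of_weakEquivalence (hf : bousfieldCofibrations 𝓘 f)
    (hf' : RelativeInjective.bousfieldWeakEquivalences 𝓘 f) : HasExtensions 𝓘 f := by
  have key (I : A) (hI : 𝓘 I) (n : ℕ) := (quasiIsoAt_homInto_iff I f (n + 1) n _ (by simp) rfl).1
    ((quasiIso_iff _).1 (hf' I hI) n)
  have cocycle (I : A) (hI : 𝓘 I) (n : ℕ) (a : X.X n ⟶ I) (ha : ∀ m, X.d m n ≫ a = 0) :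
      ∃ b : Y.X n ⟶ I, (∀ m, Y.d m n ≫ b = 0) ∧ f.f n ≫ b = a := by
    obtain ⟨b, hb, a', ha'⟩ := (key I hI n).2 a (ha _)
    obtain ⟨b', hb'⟩ := (hf I hI (n + 1) (by simp)).exists_fac a'
    refine ⟨b + Y.d n (n + 1) ≫ b', fun m => ?_, ?_⟩
    · simp [d_comp_eq_zero _ rfl hb m]
    · rw [Preadditive.comp_add, f.comm_assoc, hb', ha']
  refine ⟨fun I hI a => ?_, fun I hI n a b hb hab => ?_⟩
  · obtain ⟨b, -, hb⟩ := cocycle I hI 0 a (fun m => by rw [X.shape _ _ (by simp), zero_comp])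
    exact ⟨b, hb⟩
  -- `c'` has the right coboundary; its error on `X` is a cocycle, whose extension `z` is
  -- subtracted.
  · obtain ⟨c', hc'⟩ := (key I hI n).1 b (hb _) a hab.symm
    obtain ⟨z, hz, hz'⟩ := cocycle I hI (n + 1) (f.f (n + 1) ≫ c' - a) (d_comp_eq_zero n (by simp) (by
      simp [← hab, ← hc']))
    exact ⟨c' - z, by simp [hz, hc'], by simp [hz']⟩

end RelativeInjective

/-! ### Lifting trivial cofibrations against fibrations -/

namespace RelativeInjective

variable {A : Type u} [Category.{v} A] [Abelian A] {𝓘 : ObjectProperty A}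
  {𝓜 : MorphismProperty A}

section

variable {X Y : CochainComplex A ℕ}

/-- The construction of a map of cochain complexes by induction on the degree, where the
component in each degree is subject to a condition and only depends on the preceding one. -/
lemma exists_hom_of_succ (P : ∀ n, (X.X n ⟶ Y.X n) → Prop) (zero : ∃ φ, P 0 φ)
    (succ : ∀ n (φ : X.X n ⟶ Y.X n), P n φ → (∀ m, X.d m n ≫ φ ≫ Y.d n (n + 1) = 0) →
      ∃ φ' : X.X (n + 1) ⟶ Y.X (n + 1), P (n + 1) φ' ∧ φ ≫ Y.d n (n + 1) = X.d n (n + 1) ≫ φ') :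
    ∃ φ : X ⟶ Y, ∀ n, P n (φ.f n) := by
  choose φ₀ h₀ using zero
  choose next hnext hcomm using succ
  have hzero (n : ℕ) (φ : X.X n ⟶ Y.X n) (h : P n φ)
      (h' : ∀ m, X.d m n ≫ φ ≫ Y.d n (n + 1) = 0) (m : ℕ) :
      X.d m (n + 1) ≫ next n φ h h' ≫ Y.d (n + 1) (n + 1 + 1) = 0 :=
    d_comp_eq_zero n (by simp) (by simp [← reassoc_of% hcomm n φ h h']) m
  let S (n : ℕ) := {φ : X.X n ⟶ Y.X n // P n φ ∧ ∀ m, X.d m n ≫ φ ≫ Y.d n (n + 1) = 0}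
  let s (n : ℕ) : S n := Nat.rec
    ⟨φ₀, h₀, fun m => by rw [X.shape _ _ (by simp), zero_comp]⟩
    (fun n φ => ⟨next n φ.1 φ.2.1 φ.2.2, hnext n φ.1 φ.2.1 φ.2.2, hzero n φ.1 φ.2.1 φ.2.2⟩) n
  exact ⟨{ f := fun n => (s n).1
           comm' := by
            rintro n _ rfl
            exact hcomm n _ (s n).2.1 (s n).2.2 }, fun n => (s n).2.1⟩

end

lemma HasExtensions.hasLiftingProperty {K L X Y : CochainComplex A ℕ} {i : K ⟶ L}
    (hi : HasExtensions 𝓘 i) {p : X ⟶ Y} (hp : bousfieldFibrations 𝓘 p) :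
    HasLiftingProperty i p where
  sq_hasLift {u v} sq := by
    have hsq (n : ℕ) : u.f n ≫ p.f n = i.f n ≫ v.f n := by
      simpa using HomologicalComplex.congr_hom sq.w n
    obtain ⟨φ, hφ⟩ := exists_hom_of_succ (X := L) (Y := X)
      (fun n φ => i.f n ≫ φ = u.f n ∧ φ ≫ p.f n = v.f n) (by
        obtain ⟨_, hK⟩ := hp 0
        obtain ⟨c, hc⟩ := (hi.zero _ hK).exists_fac
          (kernel.lift (p.f 0) (u.f 0 - i.f 0 ≫ v.f 0 ≫ section_ (p.f 0)) (by simp [hsq]))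
        refine ⟨v.f 0 ≫ section_ (p.f 0) + c ≫ kernel.ι _, ?_, by simp⟩
        simp [reassoc_of% hc]) (by
        intro n φ ⟨h₁, h₂⟩ h₃
        obtain ⟨_, hK⟩ := hp (n + 1)
        -- The section gives a lift of `v` that need not match `u` or the differential; both defects
        -- lie in the kernel of `p`, and `c` corrects them together.
        obtain ⟨c, hc, hc'⟩ := hi.succ _ hK n
          (kernel.lift (p.f (n + 1))
            (u.f (n + 1) - i.f (n + 1) ≫ v.f (n + 1) ≫ section_ (p.f (n + 1))) (by simp [hsq]))
          (kernel.lift (p.f (n + 1))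
            (φ ≫ X.d n (n + 1) - L.d n (n + 1) ≫ v.f (n + 1) ≫ section_ (p.f (n + 1))) (by
              rw [Preadditive.sub_comp, Category.assoc, Category.assoc, ← p.comm, reassoc_of% h₂]
              simp))
          (fun m => by
            rw [← cancel_mono (kernel.ι _)]
            simp [h₃])
          (by
            rw [← cancel_mono (kernel.ι _)]
            simp [reassoc_of% h₁])
        refine ⟨v.f (n + 1) ≫ section_ (p.f (n + 1)) + c ≫ kernel.ι _, ⟨?_, by simp⟩, ?_⟩
        · simp [reassoc_of% hc']
        · rw [Preadditive.comp_add, reassoc_of% hc, kernel.lift_ι, add_sub_cancel])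
    exact ⟨⟨{ l := φ
              fac_left := by ext n; exact (hφ n).1
              fac_right := by ext n; exact (hφ n).2 }⟩⟩

/-! ### Sums with disks -/

section Disks

variable (Y : CochainComplex A ℕ) (J : ℕ → A)

/-- The direct sum of a cochain complex `Y` and the disks on the objects `J n`, where the disk on
`J n` is the contractible complex which is `J n` in degrees `n - 1` and `n`. -/
noncomputable abbrev addDisks : CochainComplex A ℕ :=
  CochainComplex.of (fun n => Y.X n ⊞ (J n ⊞ J (n + 1)))
    (fun n => biprod.map (Y.d n (n + 1)) (biprod.snd ≫ biprod.inl))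
    (fun n => by apply biprod.hom_ext' <;> simp)

lemma addDisks_d (n : ℕ) : (addDisks Y J).d n (n + 1) =
    biprod.map (Y.d n (n + 1)) (biprod.snd ≫ biprod.inl) := by
  simp

/-- The projection from the sum of a complex and disks. -/
noncomputable def addDisksFst : addDisks Y J ⟶ Y where
  f n := biprod.fst
  comm' := by
    rintro n _ rfl
    simp

@[simp]
lemma addDisksFst_f (n : ℕ) : (addDisksFst Y J).f n = biprod.fst := rfl

variable {Y J}

/-- The map to the sum of a complex and disks that corresponds to a map to the complex and maps
to the objects on which the disks are built. -/
noncomputable def addDisksLift {X : CochainComplex A ℕ} (f : X ⟶ Y) (w : ∀ n, X.X n ⟶ J n) :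
    X ⟶ addDisks Y J where
  f n := biprod.lift (f.f n) (biprod.lift (w n) (X.d n (n + 1) ≫ w (n + 1)))
  comm' := by
    rintro n _ rfl
    rw [addDisks_d]
    apply biprod.hom_ext
    · simp
    · apply biprod.hom_ext <;> simp

@[simp]
lemma addDisksLift_f {X : CochainComplex A ℕ} (f : X ⟶ Y) (w : ∀ n, X.X n ⟶ J n) (n : ℕ) :
    (addDisksLift f w).f n =
      biprod.lift (f.f n) (biprod.lift (w n) (X.d n (n + 1) ≫ w (n + 1))) := rfl

lemma addDisksLift_fst {X : CochainComplex A ℕ} (f : X ⟶ Y) (w : ∀ n, X.X n ⟶ J n) :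
    addDisksLift f w ≫ addDisksFst Y J = f := by
  ext n
  simp

/-- Compatibility with the differential determines the component in `J (n + 1)` in degree `n` from
the one in degree `n + 1`. -/
lemma addDisks_hom_ext {X : CochainComplex A ℕ} {g g' : X ⟶ addDisks Y J}
    (h : g ≫ addDisksFst Y J = g' ≫ addDisksFst Y J)
    (h' : ∀ n, g.f n ≫ biprod.snd ≫ biprod.fst = g'.f n ≫ biprod.snd ≫ biprod.fst) : g = g' := by
  have key (g : X ⟶ addDisks Y J) (n : ℕ) : g.f n ≫ biprod.snd ≫ biprod.snd =
      X.d n (n + 1) ≫ g.f (n + 1) ≫ biprod.snd ≫ biprod.fst := by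
    rw [← HomologicalComplex.Hom.comm_assoc, addDisks_d]
    simp
  apply HomologicalComplex.hom_ext
  intro n
  apply biprod.hom_ext
  · exact HomologicalComplex.congr_hom h n
  · apply biprod.hom_ext
    · simpa using h' n
    · simp only [Category.assoc]
      rw [key, key, h']

/-- The lift splits into one extension problem to `J n` for each `n`. Cofibrations are unconstrained
in degree 0, hence `J 0` must vanish. -/
lemma hasLiftingProperty_addDisksFst {K L : CochainComplex A ℕ} {i : K ⟶ L}
    (hi : bousfieldCofibrations 𝓘 i) (hJ : ∀ n, 𝓘 (J n)) (hJ₀ : IsZero (J 0)) :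
    HasLiftingProperty i (addDisksFst Y J) where
  sq_hasLift {u v} sq := by
    have key (n : ℕ) : ∃ w : L.X n ⟶ J n, i.f n ≫ w = u.f n ≫ biprod.snd ≫ biprod.fst := by
      cases n with
      | zero => exact ⟨0, hJ₀.eq_of_tgt _ _⟩
      | succ n => exact (hi _ (hJ _) (n + 1) (by simp)).exists_fac _
    choose w hw using key
    refine ⟨⟨{ l := addDisksLift v w, fac_left := ?_, fac_right := addDisksLift_fst _ _ }⟩⟩
    apply addDisks_hom_ext
    · rw [Category.assoc, addDisksLift_fst, sq.w]
    · intro n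
      simp [hw]

lemma IsInjectiveClass.bousfieldFibrations_addDisksFst (h : IsInjectiveClass 𝓘 𝓜)
    (hJ : ∀ n, 𝓘 (J n)) : bousfieldFibrations 𝓘 (addDisksFst Y J) := fun n =>
  ⟨inferInstanceAs (IsSplitEpi (biprod.fst : Y.X n ⊞ (J n ⊞ J (n + 1)) ⟶ Y.X n)),
    h.kernel_biprod_fst _ (h.biprod (hJ _) (hJ _))⟩

variable (Y J) in
/-- The inclusion in the sum of a complex and disks. -/
noncomputable def addDisksInl : Y ⟶ addDisks Y J := addDisksLift (𝟙 Y) (fun _ => 0)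

@[simp]
lemma addDisksInl_f (n : ℕ) : (addDisksInl Y J).f n = biprod.inl := by
  apply biprod.hom_ext
  · simp [addDisksInl]
  · apply biprod.hom_ext <;> simp [addDisksInl]

lemma hasExtensions_addDisksInl (hJ₀ : IsZero (J 0)) : HasExtensions 𝓘 (addDisksInl Y J) where
  zero I _ a := ⟨biprod.fst ≫ a, by simp⟩
  succ I _ n a b hb hab := by
    rw [addDisksInl_f] at hab
    -- The summand `J n` in degree `n` is hit by the differential when `n > 0`, and is zero when `n
    -- = 0`.
    have hb' : biprod.inl ≫ biprod.inr ≫ b = 0 := by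
      cases n with
      | zero => exact hJ₀.eq_of_src _ _
      | succ n =>
        have := hb n
        rw [addDisks_d] at this
        simpa using (biprod.inr ≫ biprod.inr) ≫= this
    refine ⟨biprod.desc a (biprod.fst ≫ biprod.inr ≫ biprod.inr ≫ b), ?_, ?_⟩
    · rw [addDisks_d]
      apply biprod.hom_ext'
      · simp [hab]
      · apply biprod.hom_ext' <;> simp [hb']
    · rw [addDisksInl_f]
      exact biprod.inl_desc _ _

end Disks

end RelativeInjective

/-! ### The two factorizations -/

namespace RelativeInjective

variable {A : Type u} [Category.{v} A] [Abelian A] {𝓘 : ObjectProperty A}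
  {𝓜 : MorphismProperty A}

lemma IsInjectiveClass.exists_cofibration_fac (h : IsInjectiveClass 𝓘 𝓜)
    {X Y : CochainComplex A ℕ} (f : X ⟶ Y) :
    ∃ (J : ℕ → A) (i : X ⟶ addDisks Y J), (∀ n, 𝓘 (J n)) ∧ IsZero (J 0) ∧
      bousfieldCofibrations 𝓘 i ∧ i ≫ addDisksFst Y J = f := by
  have key (n : ℕ) : ∃ (J : A) (w : X.X n ⟶ J), 𝓘 J ∧ (n = 0 → IsZero J) ∧
      (0 < n → ∀ I, 𝓘 I → IsMonicFor I w) := by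
    cases n with
    | zero => exact ⟨_, 0, h.of_isZero (isZero_zero _), fun _ => isZero_zero _, by simp⟩
    | succ n =>
      obtain ⟨J, w, hJ, hw⟩ := h.exists_isMonicFor (X.X (n + 1))
      exact ⟨J, w, hJ, by simp, fun _ => hw⟩
  choose J w hJ hJ₀ hw using key
  refine ⟨J, addDisksLift f w, hJ, hJ₀ 0 rfl, fun I hI n hn a => ?_, addDisksLift_fst _ _⟩
  obtain ⟨b, hb⟩ := (hw n hn I hI).exists_fac a
  exact ⟨biprod.snd ≫ biprod.fst ≫ b, by simp [hb]⟩

section Factorization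

variable {X Y : CochainComplex A ℕ} (f : X ⟶ Y)

/-- The data in degree `n` of a factorization `X ⟶ Z ⟶ Y` which has been constructed up to that
degree: the object `Z`, its maps from `X` and to `Y`, and the preceding differential `e`. -/
structure PartialFactorization (n : ℕ) where
  /-- the object in degree `n - 1` -/
  P : A
  /-- the object in degree `n` -/
  Z : A
  /-- the differential -/
  e : P ⟶ Z
  /-- the component of the map from `X` -/
  i : X.X n ⟶ Z
  /-- the component of the map to `Y` -/
  p : Z ⟶ Y.X n
  fac : i ≫ p = f.f n
  e_p_d : e ≫ p ≫ Y.d n (n + 1) = 0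

variable {f}

lemma IsInjectiveClass.exists_fac (h : IsInjectiveClass 𝓘 𝓜) {Q T : A} (g : Q ⟶ T) :
    ∃ (Z : A) (j : Q ⟶ Z) (p : Z ⟶ T), j ≫ p = g ∧ (IsSplitEpi p ∧ 𝓘 (kernel p)) ∧
      ∀ I, 𝓘 I → IsMonicFor I j := by
  obtain ⟨J, w, hJ, hw⟩ := h.exists_isMonicFor Q
  refine ⟨T ⊞ J, biprod.lift g w, biprod.fst, by simp,
    ⟨inferInstance, h.kernel_biprod_fst _ hJ⟩, fun I hI a => ?_⟩
  obtain ⟨b, hb⟩ := (hw I hI).exists_fac a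
  exact ⟨biprod.snd ≫ b, by simp [hb]⟩

/-- Maps to `I` from the pushout of `X^{n+1}` and the cokernel of `s.e` over `X^n` are exactly the
compatible pairs `(a, b)`. A relative monic out of this pushout therefore solves the extension
problem. -/
lemma PartialFactorization.exists_succ {n : ℕ} (s : PartialFactorization f n)
    (h : IsInjectiveClass 𝓘 𝓜) :
    ∃ (Z : A) (e : s.Z ⟶ Z) (i : X.X (n + 1) ⟶ Z) (p : Z ⟶ Y.X (n + 1)),
      i ≫ p = f.f (n + 1) ∧ e ≫ p = s.p ≫ Y.d n (n + 1) ∧ s.e ≫ e = 0 ∧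
      s.i ≫ e = X.d n (n + 1) ≫ i ∧ (IsSplitEpi p ∧ 𝓘 (kernel p)) ∧
      ∀ I, 𝓘 I → ∀ (a : X.X (n + 1) ⟶ I) (b : s.Z ⟶ I), s.e ≫ b = 0 →
        s.i ≫ b = X.d n (n + 1) ≫ a → ∃ c : Z ⟶ I, e ≫ c = b ∧ i ≫ c = a := by
  obtain ⟨Z, j, p, hjp, hp, hj⟩ := h.exists_fac
    (pushout.desc (f.f (n + 1)) (cokernel.desc s.e (s.p ≫ Y.d n (n + 1)) s.e_p_d)
      (by simp [reassoc_of% s.fac]) :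
        pushout (X.d n (n + 1)) (s.i ≫ cokernel.π s.e) ⟶ Y.X (n + 1))
  refine ⟨Z, cokernel.π s.e ≫ pushout.inr _ _ ≫ j, pushout.inl _ _ ≫ j, p,
    by rw [Category.assoc, hjp, pushout.inl_desc],
    by rw [Category.assoc, Category.assoc, hjp, pushout.inr_desc, cokernel.π_desc],
    by simp, by simp [pushout.condition_assoc], hp, fun I hI a b hb hab => ?_⟩
  obtain ⟨c, hc⟩ := (hj I hI).exists_fac
    (pushout.desc a (cokernel.desc s.e b hb) (by simp [hab]))
  exact ⟨c, by rw [Category.assoc, Category.assoc, hc, pushout.inr_desc, cokernel.π_desc],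
    by rw [Category.assoc, hc, pushout.inl_desc]⟩

lemma IsInjectiveClass.exists_hasExtensions_fac (h : IsInjectiveClass 𝓘 𝓜)
    {X Y : CochainComplex A ℕ} (f : X ⟶ Y) :
    ∃ (Z : CochainComplex A ℕ) (i : X ⟶ Z) (p : Z ⟶ Y), i ≫ p = f ∧ HasExtensions 𝓘 i ∧
      bousfieldFibrations 𝓘 p := by
  obtain ⟨Z₀, i₀, p₀, hfac₀, hp₀, hi₀⟩ := h.exists_fac (f.f 0)
  choose Z e i p hip hep hee hie hp hext using
    fun n (s : PartialFactorization f n) => s.exists_succ h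
  let s₀ : PartialFactorization f 0 :=
    { P := Z₀, Z := Z₀, e := 0, i := i₀, p := p₀, fac := hfac₀, e_p_d := by simp }
  let next (n : ℕ) (s : PartialFactorization f n) : PartialFactorization f (n + 1) :=
    { P := s.Z, Z := Z n s, e := e n s, i := i n s, p := p n s, fac := hip n s
      e_p_d := by simp [reassoc_of% hep] }
  let s (n : ℕ) : PartialFactorization f n := Nat.rec s₀ next n
  let W : CochainComplex A ℕ := CochainComplex.of (fun n => (s n).Z) (fun n => e n (s n))
    (fun n => hee (n + 1) (s (n + 1)))
  have hW (n : ℕ) : W.d n (n + 1) = e n (s n) := by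
    simp [W]
  refine ⟨W, { f := fun n => (s n).i, comm' := ?_ }, { f := fun n => (s n).p, comm' := ?_ },
    ?_, ⟨hi₀, fun I hI n a b hb hab => ?_⟩, ?_⟩
  · rintro n _ rfl
    rw [hW]
    exact hie n (s n)
  · rintro n _ rfl
    rw [hW]
    exact (hep n (s n)).symm
  · ext n
    exact (s n).fac
  · rw [hW]
    refine hext n (s n) I hI a b ?_ hab
    cases n with
    | zero => exact zero_comp
    | succ n =>
      have := hb n
      rwa [hW] at this
  · rintro (_ | n)
    · exact hp₀
    · exact hp n (s n)

end Factorization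

/-! ### Retracts, two-out-of-three and the model structure -/

lemma IsInjectiveClass.bousfieldFibrations_of_retract (h : IsInjectiveClass 𝓘 𝓜)
    {X Y X' Y' : CochainComplex A ℕ} {f : X ⟶ Y} {g : X' ⟶ Y'} (r : RetractArrow f g)
    (hg : bousfieldFibrations 𝓘 g) : bousfieldFibrations 𝓘 f := fun n => by
  obtain ⟨_, hK⟩ := hg n
  let r' := r.map (HomologicalComplex.eval A (ComplexShape.up ℕ) n)
  have i_w : r.i.left.f n ≫ g.f n = f.f n ≫ r.i.right.f n := r'.i_w
  have r_w : r.r.left.f n ≫ f.f n = g.f n ≫ r.r.right.f n := r'.r_w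
  have left : r.i.left.f n ≫ r.r.left.f n = 𝟙 _ := r'.retract_left
  have right : r.i.right.f n ≫ r.r.right.f n = 𝟙 _ := r'.retract_right
  refine ⟨⟨⟨{ section_ := r.i.right.f n ≫ section_ (g.f n) ≫ r.r.left.f n
              id := by simp [r_w, right] }⟩⟩, ?_⟩
  exact h.of_retract
    { i := kernel.map _ _ _ _ i_w.symm
      r := kernel.map _ _ _ _ r_w.symm
      retract := by
        rw [← cancel_mono (kernel.ι _)]
        simp [left] } hK

lemma bousfieldCofibrations_of_retract
    {X Y X' Y' : CochainComplex A ℕ} {f : X ⟶ Y} {g : X' ⟶ Y'} (r : RetractArrow f g)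
    (hg : bousfieldCofibrations 𝓘 g) : bousfieldCofibrations 𝓘 f := fun I hI n hn a => by
  let r' := r.map (HomologicalComplex.eval A (ComplexShape.up ℕ) n)
  have i_w : r.i.left.f n ≫ g.f n = f.f n ≫ r.i.right.f n := r'.i_w
  have left : r.i.left.f n ≫ r.r.left.f n = 𝟙 _ := r'.retract_left
  obtain ⟨b, hb⟩ := (hg I hI n hn).exists_fac (r.r.left.f n ≫ a)
  refine ⟨r.i.right.f n ≫ b, ?_⟩
  dsimp only
  rw [← reassoc_of% i_w, hb, reassoc_of% left]

instance : (bousfieldWeakEquivalences 𝓘).HasTwoOutOfThreeProperty where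
  comp_mem f g hf hg I hI := by
    have := hf I hI
    have := hg I hI
    rw [op_comp, Functor.map_comp]
    infer_instance
  of_postcomp f g hg hfg I hI := by
    have := hg I hI
    have := hfg I hI
    rw [op_comp, Functor.map_comp] at this
    exact quasiIso_of_comp_left ((homInto I).map g.op) _
  of_precomp f g hf hfg I hI := by
    have := hf I hI
    have := hfg I hI
    rw [op_comp, Functor.map_comp] at this
    exact quasiIso_of_comp_right _ ((homInto I).map f.op)

lemma bousfieldWeakEquivalences_id (X : CochainComplex A ℕ) :
    bousfieldWeakEquivalences 𝓘 (𝟙 X) := fun I _ => by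
  rw [op_id, CategoryTheory.Functor.map_id]
  infer_instance

lemma bousfieldWeakEquivalences_of_retract
    {X Y X' Y' : CochainComplex A ℕ} {f : X ⟶ Y} {g : X' ⟶ Y'} (r : RetractArrow f g)
    (hg : bousfieldWeakEquivalences 𝓘 g) : bousfieldWeakEquivalences 𝓘 f := fun I hI =>
  MorphismProperty.of_retract (P := HomologicalComplex.quasiIso _ _)
    (r.op.map (homInto I)) (hg I hI)

/-- It is a retraction of the weak equivalence `addDisksInl`. -/
lemma bousfieldWeakEquivalences_addDisksFst {Y : CochainComplex A ℕ} {J : ℕ → A}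
    (hJ₀ : IsZero (J 0)) : bousfieldWeakEquivalences 𝓘 (addDisksFst Y J) := by
  apply MorphismProperty.of_precomp (W' := bousfieldWeakEquivalences 𝓘) _ (addDisksInl Y J) _
    (hasExtensions_addDisksInl hJ₀).bousfieldWeakEquivalences
  rw [addDisksInl, addDisksLift_fst]
  exact bousfieldWeakEquivalences_id Y

/-- In the factorization of `p` through `addDisks`, two-out-of-three makes `j` a trivial
cofibration. It lifts against `p`, so `p` is a retract of `addDisksFst`. -/
lemma IsInjectiveClass.hasLiftingProperty_of_weakEquivalence (h : IsInjectiveClass 𝓘 𝓜)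
    {K L X Y : CochainComplex A ℕ} {i : K ⟶ L} {p : X ⟶ Y} (hi : bousfieldCofibrations 𝓘 i)
    (hp : bousfieldFibrations 𝓘 p) (hp' : bousfieldWeakEquivalences 𝓘 p) :
    HasLiftingProperty i p := by
  obtain ⟨J, j, hJ, hJ₀, hj, fac⟩ := h.exists_cofibration_fac p
  have hj' : HasExtensions 𝓘 j := hasExtensions_of_cofibration_of_weakEquivalence hj (by
    rw [← fac] at hp'
    exact MorphismProperty.of_postcomp (W' := bousfieldWeakEquivalences 𝓘) _ _ _
      (bousfieldWeakEquivalences_addDisksFst hJ₀) hp')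
  have := hj'.hasLiftingProperty hp
  have := hasLiftingProperty_addDisksFst (Y := Y) hi hJ hJ₀
  exact (RetractArrow.ofRightLiftingProperty fac).rightLiftingProperty i

/-- The model structure on nonnegatively graded cochain complexes that is attached to an injective
class. -/
@[reducible]
noncomputable def IsInjectiveClass.modelCategory (h : IsInjectiveClass 𝓘 𝓜) :
    ModelCategory (CochainComplex A ℕ) where
  categoryWithFibrations := ⟨bousfieldFibrations 𝓘⟩
  categoryWithCofibrations := ⟨bousfieldCofibrations 𝓘⟩
  categoryWithWeakEquivalences := ⟨bousfieldWeakEquivalences 𝓘⟩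
  cm2 := inferInstanceAs (bousfieldWeakEquivalences 𝓘).HasTwoOutOfThreeProperty
  cm3a := ⟨bousfieldWeakEquivalences_of_retract⟩
  cm3b := ⟨h.bousfieldFibrations_of_retract⟩
  cm3c := ⟨bousfieldCofibrations_of_retract⟩
  cm4a _ _ hi hi' hp :=
    (hasExtensions_of_cofibration_of_weakEquivalence hi.mem hi'.mem).hasLiftingProperty hp.mem
  cm4b _ _ hi hp hp' := h.hasLiftingProperty_of_weakEquivalence hi.mem hp.mem hp'.mem
  cm5a := ⟨fun f => by
    obtain ⟨Z, i, p, fac, hi, hp⟩ := h.exists_hasExtensions_fac f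
    exact ⟨⟨Z, i, p, fac, ⟨hi.bousfieldCofibrations, hi.bousfieldWeakEquivalences⟩, hp⟩⟩⟩
  cm5b := ⟨fun f => by
    obtain ⟨J, i, hJ, hJ₀, hi, fac⟩ := h.exists_cofibration_fac f
    exact ⟨⟨_, i, _, fac, hi, ⟨h.bousfieldFibrations_addDisksFst hJ,
      bousfieldWeakEquivalences_addDisksFst hJ₀⟩⟩⟩⟩

lemma bousfieldCofibrations_of_isZero {X Y : CochainComplex A ℕ} (f : X ⟶ Y) (hX : IsZero X) :
    bousfieldCofibrations 𝓘 f := fun _ _ n _ _ =>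
  ⟨0, ((HomologicalComplex.eval A (ComplexShape.up ℕ) n).map_isZero hX).eq_of_src _ _⟩

lemma IsInjectiveClass.bousfieldFibrations_iff_of_isZero (h : IsInjectiveClass 𝓘 𝓜)
    {X Y : CochainComplex A ℕ} (f : X ⟶ Y) (hY : IsZero Y) :
    bousfieldFibrations 𝓘 f ↔ ∀ n, 𝓘 (X.X n) := by
  have hY' (n : ℕ) : IsZero (Y.X n) :=
    (HomologicalComplex.eval A (ComplexShape.up ℕ) n).map_isZero hY
  have hf (n : ℕ) : f.f n = 0 := (hY' n).eq_of_tgt _ _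
  have e (n : ℕ) : kernel (f.f n) ≅ X.X n :=
    { hom := kernel.ι _
      inv := kernel.lift _ (𝟙 _) (by simp [hf])
      hom_inv_id := by
        rw [← cancel_mono (kernel.ι _)]
        simp }
  exact ⟨fun hp n => h.of_retract (Retract.ofIso (e n).symm) (hp n).2,
    fun hX n => ⟨⟨⟨{ section_ := 0, id := (hY' n).eq_of_tgt _ _ }⟩⟩,
      h.of_retract (Retract.ofIso (e n)) (hX n)⟩⟩

end RelativeInjective

theorem corollary5p2 {A : Type u} [Category.{v} A] [Abelian A]
    [HasLimits A] [HasColimits A]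
    (𝓘 : ObjectProperty A) (𝓜 : MorphismProperty A)
    (h : RelativeInjective.IsInjectiveClass 𝓘 𝓜) :
    ∃ _ : ModelCategory (CochainComplex A ℕ),
      weakEquivalences (CochainComplex A ℕ) = RelativeInjective.bousfieldWeakEquivalences 𝓘 ∧
      cofibrations (CochainComplex A ℕ) = RelativeInjective.bousfieldCofibrations 𝓘 ∧
      fibrations (CochainComplex A ℕ) = RelativeInjective.bousfieldFibrations 𝓘 ∧
      (∀ X : CochainComplex A ℕ, IsCofibrant X) ∧
      (∀ X : CochainComplex A ℕ, IsFibrant X ↔ ∀ n : ℕ, 𝓘 (X.X n)) := by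
  let := h.modelCategory
  refine ⟨h.modelCategory, rfl, rfl, rfl, fun X => ?_, fun X => ?_⟩
  · rw [isCofibrant_iff, cofibration_iff]
    exact RelativeInjective.bousfieldCofibrations_of_isZero _
      ((isZero_zero _).of_iso (initialIsInitial.uniqueUpToIso (isZero_zero _).isInitial))
  · rw [isFibrant_iff, fibration_iff]
    exact h.bousfieldFibrations_iff_of_isZero _
      ((isZero_zero _).of_iso (terminalIsTerminal.uniqueUpToIso (isZero_zero _).isTerminal))
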